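/- Consider Markov decision processes (MDPs) with total reward criterion, with $N$ states and $m$ actions. Each action $a$ is available at one state, every state has at least one action, $a$ has a reward $c_a\in\mathbb R$ and leads to state $s$ with probability $P_{a,s}$, where the row $P_{a,\cdot}$ either sums to $1$ or is zero (then $a$ ends the process; a sink is a state whose only action ends the process). Under every policy a process-ending action is reachable from every state. Let $J\in\{0,1\}^{m\times N}$ be the incidence matrix of actions and states and $\mathbf e\in\mathbb R^N$ the all-one vector. The linear program of the MDP is $$\text{minimize } \mathbf e^{T}y\quad\text{subject to}\quad (J-P)\,y\ge c ,$$ of dimension $N$ and with $m$ constraints. The simplex method is run on its standard-form dual, maximize $c^{T}x$ subject to $(J-P)^{T}x=\mathbf e$, $x\ge 0$, whose feasible bases are the policies. Under Bland's rule, for the fixed numbering of the actions, the entering variable is the improving variable of least index, and the leaving variable is the one of least index among those attaining the minimum in the ratio test. A pair $(P',c')$ is an MDP-smoothed perturbation of $(P,c)$ of up to $\sigma$ if: $P'\ge 0$ and $P'$ has the same zero entries and the same row sums as $P$; in each row of $P$, each nonzero entry other than the first one changes by at most $\sigma$ (the first one is then determined by the row sum); zero rewards stay zero and the other rewards change by at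 most $\sigma$. ($J$ and $\mathbf e$ are not perturbed.) **Theorem.** The worst-case MDP-smoothed complexity of the simplex method with Bland's rule, for LPs of dimension $N$ with $O(N)$ constraints and perturbations of up to $\tfrac12$, is $2^{\Omega(N)}$. That is, there are $\kappa>0$ and $C,N_0\in\mathbb N$ such that for every $N\ge N_0$ there are an MDP with $N$ states and $m\le CN$ actions (with a numbering of its actions) and an initial basis such that, for every MDP-smoothed perturbation $(P',c')$ of up to $\tfrac12$, the simplex method with Bland's rule, started from that basis on the LP of $(J,P',c')$, makes at least $2^{\kappa N}$ pivots. Hence for every probability distribution on such perturbations the expected number of pivots is at least $2^{\kappa N}$. -/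

import Mathlib

open MeasureTheory
open scoped ENNReal Matrix

noncomputable section

/-! ## Linear programs and the simplex method with Bland's rule -/

/-- The linear program `maximise c · x subject to A x = b, x ≥ 0` with `n` equality constraints
and `m` variables. The variables are numbered by `Fin m`. -/
structure StandardLP (n m : ℕ) where
  A : Matrix (Fin n) (Fin m) ℝ
  b : Fin n → ℝ
  c : Fin m → ℝ

/-- The linear program `minimise b · y subject to A y ≥ c`, of dimension `N` (the number of
variables) and with `m` constraints. -/
structure InequalityLP (N m : ℕ) where
  A : Matrix (Fin m) (Fin N) ℝ
  b : Fin N → ℝ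
  c : Fin m → ℝ

/-- The linear programming dual: `maximise c · x subject to Aᵀ x = b, x ≥ 0`. -/
def InequalityLP.dual {N m : ℕ} (L : InequalityLP N m) : StandardLP N m :=
  ⟨L.Aᵀ, L.b, L.c⟩

namespace StandardLP

variable {n m : ℕ} (L : StandardLP n m)

/-- The basis matrix of a choice `β` of basic variables (`β i` is the basic variable of row `i`
of the tableau). -/
def basisMatrix (β : Fin n → Fin m) : Matrix (Fin n) (Fin n) ℝ :=
  L.A.submatrix id β

/-- The values of the basic variables in the basic solution of `β`. -/
def basicSolution (β : Fin n → Fin m) : Fin n → ℝ :=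
  (L.basisMatrix β)⁻¹ *ᵥ L.b

/-- `β` is a basis, and its basic solution is feasible. -/
def IsFeasibleBasis (β : Fin n → Fin m) : Prop :=
  IsUnit (L.basisMatrix β).det ∧ ∀ i, 0 ≤ L.basicSolution β i

/-- The simplex multipliers of `β` (the basic solution of the dual program). -/
def multipliers (β : Fin n → Fin m) : Fin n → ℝ :=
  (fun i => L.c (β i)) ᵥ* (L.basisMatrix β)⁻¹

/-- The reduced cost of the variable `j` at the basis `β`; the variable is improving if it is
positive. -/
def reducedCost (β : Fin n → Fin m) (j : Fin m) : ℝ :=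
  L.c j - L.multipliers β ⬝ᵥ (fun i => L.A i j)

/-- The column of the variable `j` in the tableau of `β`: the rates at which the basic variables
decrease when `j` increases. -/
def tableauColumn (β : Fin n → Fin m) (j : Fin m) : Fin n → ℝ :=
  (L.basisMatrix β)⁻¹ *ᵥ (fun i => L.A i j)

/-- Bland's choice of the entering variable: the improving variable of least index. -/
def IsBlandEntering (β : Fin n → Fin m) (j : Fin m) : Prop :=
  0 < L.reducedCost β j ∧ ∀ k, 0 < L.reducedCost β k → j ≤ k

/-- Bland's choice of the leaving variable: row `i` passes the ratio test for the entering variable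
`j`, and among the rows that pass it, its basic variable has the least index. -/
def IsBlandLeaving (β : Fin n → Fin m) (j : Fin m) (i : Fin n) : Prop :=
  0 < L.tableauColumn β j i ∧
    ∀ k, 0 < L.tableauColumn β j k →
      L.basicSolution β i / L.tableauColumn β j i ≤
          L.basicSolution β k / L.tableauColumn β j k ∧
        (L.basicSolution β i / L.tableauColumn β j i =
          L.basicSolution β k / L.tableauColumn β j k → β i ≤ β k)

/-- One pivot of the simplex method with Bland's rule leads from the feasible basis `β` to `β'`. -/
def BlandPivot (β β' : Fin n → Fin m) : Prop :=
  L.IsFeasibleBasis β ∧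
    ∃ j i, L.IsBlandEntering β j ∧ L.IsBlandLeaving β j i ∧ β' = Function.update β i j

/-- A pivot is determined by the basis at which it is made. -/
theorem BlandPivot.unique {β β₁ β₂ : Fin n → Fin m}
    (h₁ : L.BlandPivot β β₁) (h₂ : L.BlandPivot β β₂) : β₁ = β₂ := by
  obtain ⟨⟨hB, -⟩, j₁, i₁, hj₁, hi₁, rfl⟩ := h₁
  obtain ⟨-, j₂, i₂, hj₂, hi₂, rfl⟩ := h₂
  have hj : j₁ = j₂ := le_antisymm (hj₁.2 _ hj₂.1) (hj₂.2 _ hj₁.1)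
  subst hj
  have h12 := hi₁.2 _ hi₂.1
  have h21 := hi₂.2 _ hi₁.1
  have he := le_antisymm h12.1 h21.1
  have hβ : β i₁ = β i₂ := le_antisymm (h12.2 he) (h21.2 he.symm)
  have hi : i₁ = i₂ := by
    by_contra hne
    refine hB.ne_zero (Matrix.det_zero_of_column_eq hne fun r => ?_)
    simp [basisMatrix, hβ]
  rw [hi]

/-- The number of pivots that the simplex method with Bland's rule makes from the basis `β₀` until
no further pivot is possible (`⊤` if it never stops). Pivots are deterministic, so this is the
length of the unique maximal run. -/
def blandPivots (β₀ : Fin n → Fin m) : ℕ∞ :=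
  ⨆ (k : ℕ) (_ : ∃ β : ℕ → Fin n → Fin m,
    β 0 = β₀ ∧ ∀ t < k, L.BlandPivot (β t) (β (t + 1))), (k : ℕ∞)

end StandardLP

/-! ## Markov decision processes and their linear programs -/

/-- A Markov decision process with `N` states and `m` actions for the total reward criterion.
Every action either leads to a random next state or ends the process; a sink is a state whose only
action ends the process (the reward of that action is the reward of reaching the sink). Whatever
policy is followed, a process-ending action can be reached from every state, so that the process
ends almost surely. -/
structure MDP (N m : ℕ) where
  /-- The state at which an action is available. -/
  owner : Fin m → Fin N
  /-- `P a s` is the probability that action `a` leads to state `s`. -/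
  P : Fin m → Fin N → ℝ
  /-- `c a` is the reward of action `a`. -/
  c : Fin m → ℝ
  owner_surjective : Function.Surjective owner
  P_nonneg : ∀ a s, 0 ≤ P a s
  P_sum : ∀ a, ∑ s, P a s = 1 ∨ ∀ s, P a s = 0
  terminates : ∀ π : Fin N → Fin m, (∀ s, owner (π s) = s) →
    ∀ s, ∃ t, Relation.ReflTransGen (fun u v => 0 < P (π u) v) s t ∧ ∀ v, P (π t) v = 0

/-- The incidence matrix of actions and states. -/
def incidence {N m : ℕ} (owner : Fin m → Fin N) : Matrix (Fin m) (Fin N) ℝ :=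
  Matrix.of fun a s => if owner a = s then 1 else 0

/-- The linear program `minimise e · y subject to (J - P) y ≥ c` with `e` the all-one vector and
`J` the incidence matrix of `owner`. -/
def valueLP {N m : ℕ} (owner : Fin m → Fin N) (P : Fin m → Fin N → ℝ) (c : Fin m → ℝ) :
    InequalityLP N m :=
  ⟨incidence owner - Matrix.of P, fun _ => 1, c⟩

/-- `(P', c')` arises from the probabilities and rewards of `M` by a structure-preserving
perturbation of up to `σ`. In each row of `P`, all nonzero entries but the first are perturbed by at
most `σ`, and the first nonzero entry is adjusted so that the row sum is kept; nonzero
probabilities stay positive and zero entries stay zero. (In a row with an entry `1` nothing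
changes.) The nonzero rewards are perturbed by at most `σ`, and zero rewards stay zero. -/
structure MDP.IsSmoothed {N m : ℕ} (M : MDP N m) (σ : ℝ)
    (P' : Fin m → Fin N → ℝ) (c' : Fin m → ℝ) : Prop where
  P_nonneg : ∀ a s, 0 ≤ P' a s
  P_support : ∀ a s, P' a s = 0 ↔ M.P a s = 0
  P_sum : ∀ a, ∑ s, P' a s = ∑ s, M.P a s
  P_close : ∀ a s, (∃ t < s, M.P a t ≠ 0) → |P' a s - M.P a s| ≤ σ
  c_zero : ∀ a, M.c a = 0 → c' a = 0
  c_close : ∀ a, |c' a - M.c a| ≤ σ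

/-- The number of pivots made from the initial basis `β₀` by the simplex method with Bland's rule
on the linear program with incidence matrix given by `owner`, probabilities `P` and rewards `c`. The
method runs on the dual, standard-form program
`maximise c · x subject to (J - P)ᵀ x = e, x ≥ 0`, whose feasible bases are the policies and whose
simplex multipliers are their values. -/
def mdpBlandPivots {N m : ℕ} (owner : Fin m → Fin N) (P : Fin m → Fin N → ℝ) (c : Fin m → ℝ)
    (β₀ : Fin N → Fin m) : ℕ∞ :=
  (valueLP owner P c).dual.blandPivots β₀

end

/-! The hard instance is a deterministic ladder. Its transition probabilities are 0 and 1, so a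
perturbation leaves them alone; only the nonzero rewards move, by at most 1/2. Everything therefore
rests on sign conditions with enough margin for such errors. At level `k` both choices at the first
state pay exactly 0 and both choices at the second pay about 4^(k+1). So the better choice at either
state is decided by the sign of the gap `g` between the two values of level `k + 1`
(`improving_iff`). While the two bits of level `k` agree, its own gap is about -4^(k+1). When the
sign of `g` flips, Bland's rule lets the first bit follow; the gap of level `k` becomes about |g| -
4^(k+1), which is positive because |g| is at least about 4^(k+2). This flip sets off a full run on
the levels below. Only then does the second bit follow; the bits agree again, the gap turns
negative, and a second run below takes place. Hence T(k+1) = 2 T(k) + 2 with T(0) = 0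
(`exists_stepsTo`). All bits start `false` although the sinks favour `true`, which is one flip at
the top. Transitions go to larger indices, so policies have triangular basis matrices and a pivot
switches the action at a single state (`valueLP_blandPivot`). `Step.blandPivot` turns ladder steps
into pivots. -/

section Triangular

/-! ### Simplex pivots at policies of an acyclic MDP. -/

variable {N m : ℕ} {owner : Fin m → Fin N} {P : Fin m → Fin N → ℝ} {c : Fin m → ℝ}
  {β : Fin N → Fin m}

theorem valueLP_dual_A_apply (i : Fin N) (a : Fin m) :
    (valueLP owner P c).dual.A i a = (if owner a = i then 1 else 0) - P a i := by
  simp [valueLP, InequalityLP.dual, incidence]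

/-- The basis matrix of a policy is triangular with ones on the diagonal if all transitions lead to
states of larger index. -/
theorem valueLP_det_basisMatrix (hP : ∀ a t, P a t ≠ 0 → owner a < t)
    (hβ : ∀ s, owner (β s) = s) : ((valueLP owner P c).dual.basisMatrix β).det = 1 := by
  have happ : ∀ i j, (valueLP owner P c).dual.basisMatrix β i j =
      (if j = i then 1 else 0) - P (β j) i := fun i j => by
    simp [StandardLP.basisMatrix, valueLP_dual_A_apply, hβ]
  have hzero : ∀ i j, i ≤ j → P (β j) i = 0 := fun i j hij => by
    by_contra h
    have := hP _ _ h
    rw [hβ] at this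
    exact absurd hij (not_le.2 this)
  rw [Matrix.det_of_isLowerTriangular _ fun i j hij => ?_]
  · exact Finset.prod_eq_one fun i _ => by simp [happ, hzero i i le_rfl]
  · have hij : i < j := hij
    rw [happ, hzero i j hij.le, if_neg hij.ne', sub_zero]

theorem valueLP_isUnit_det (hP : ∀ a t, P a t ≠ 0 → owner a < t)
    (hβ : ∀ s, owner (β s) = s) : IsUnit ((valueLP owner P c).dual.basisMatrix β).det := by
  rw [valueLP_det_basisMatrix hP hβ]
  exact isUnit_one

/-- Flow conservation: the recursion runs over predecessors, so induction along the states computes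
both the basic solution and the tableau columns. -/
theorem valueLP_inv_mulVec_apply (hP : ∀ a t, P a t ≠ 0 → owner a < t)
    (hβ : ∀ s, owner (β s) = s) (w : Fin N → ℝ) (i : Fin N) :
    (((valueLP owner P c).dual.basisMatrix β)⁻¹ *ᵥ w) i =
      w i + ∑ j, P (β j) i * (((valueLP owner P c).dual.basisMatrix β)⁻¹ *ᵥ w) j := by
  set B := (valueLP owner P c).dual.basisMatrix β with hB
  have h : B *ᵥ (B⁻¹ *ᵥ w) = w := by
    rw [Matrix.mulVec_mulVec, Matrix.mul_nonsing_inv _ (valueLP_isUnit_det hP hβ),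
      Matrix.one_mulVec]
  have hi := congrFun h i
  have happ : ∀ j, B i j = (if i = j then 1 else 0) - P (β j) i := fun j => by
    simp [hB, StandardLP.basisMatrix, valueLP_dual_A_apply, hβ, eq_comm]
  rw [Matrix.mulVec, dotProduct] at hi
  simp only [happ, sub_mul, Finset.sum_sub_distrib, ite_mul, one_mul, zero_mul,
    Finset.sum_ite_eq, Finset.mem_univ, if_true] at hi
  linarith

/-- The simplex multipliers of a policy are its values. -/
theorem valueLP_multipliers_apply (hP : ∀ a t, P a t ≠ 0 → owner a < t)
    (hβ : ∀ s, owner (β s) = s) (s : Fin N) :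
    (valueLP owner P c).dual.multipliers β s =
      c (β s) + ∑ t, P (β s) t * (valueLP owner P c).dual.multipliers β t := by
  set v := (valueLP owner P c).dual.multipliers β with hv
  set B := (valueLP owner P c).dual.basisMatrix β with hB
  have h : v ᵥ* B = fun i => c (β i) := by
    rw [hv, StandardLP.multipliers, Matrix.vecMul_vecMul,
      Matrix.nonsing_inv_mul _ (valueLP_isUnit_det hP hβ), Matrix.vecMul_one]
    rfl
  have hs := congrFun h s
  have happ : ∀ j, B j s = (if j = s then 1 else 0) - P (β s) j := fun j => by
    simp [hB, StandardLP.basisMatrix, valueLP_dual_A_apply, hβ, eq_comm]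
  rw [Matrix.vecMul, dotProduct] at hs
  simp only [happ, mul_sub, Finset.sum_sub_distrib, mul_ite, mul_one, mul_zero,
    Finset.sum_ite_eq', Finset.mem_univ, if_true] at hs
  rw [← hs, sub_add_eq_add_sub, eq_sub_iff_add_eq]
  exact congrArg _ (Finset.sum_congr rfl fun t _ => mul_comm _ _)

theorem valueLP_reducedCost (a : Fin m) :
    (valueLP owner P c).dual.reducedCost β a =
      c a + ∑ t, P a t * (valueLP owner P c).dual.multipliers β t -
        (valueLP owner P c).dual.multipliers β (owner a) := by
  rw [StandardLP.reducedCost, dotProduct]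
  simp only [valueLP_dual_A_apply, mul_sub, Finset.sum_sub_distrib, mul_ite, mul_one, mul_zero,
    Finset.sum_ite_eq, Finset.mem_univ, if_true]
  rw [Finset.sum_congr rfl fun t _ => mul_comm (P a t) _]
  change c a - _ = _
  ring

theorem valueLP_one_le_basicSolution (hP : ∀ a t, P a t ≠ 0 → owner a < t)
    (hP0 : ∀ a t, 0 ≤ P a t) (hβ : ∀ s, owner (β s) = s) (i : Fin N) :
    1 ≤ (valueLP owner P c).dual.basicSolution β i := by
  induction i using WellFoundedLT.induction with
  | ind i ih =>
    have h := valueLP_inv_mulVec_apply (c := c) hP hβ (valueLP owner P c).dual.b i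
    change (valueLP owner P c).dual.basicSolution β i =
      1 + ∑ j, P (β j) i * (valueLP owner P c).dual.basicSolution β j at h
    rw [h, le_add_iff_nonneg_right]
    refine Finset.sum_nonneg fun j _ => ?_
    by_cases hz : P (β j) i = 0
    · simp [hz]
    · have hj := hP _ _ hz
      rw [hβ] at hj
      exact mul_nonneg (hP0 _ _) (zero_le_one.trans (ih j hj))

theorem valueLP_tableauColumn_apply (hP : ∀ a t, P a t ≠ 0 → owner a < t)
    (hβ : ∀ s, owner (β s) = s) (a : Fin m) (i : Fin N) :
    (valueLP owner P c).dual.tableauColumn β a i = (if owner a = i then 1 else 0) - P a i +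
      ∑ j, P (β j) i * (valueLP owner P c).dual.tableauColumn β a j := by
  have h := valueLP_inv_mulVec_apply (c := c) hP hβ
    (fun i => (valueLP owner P c).dual.A i a) i
  rwa [valueLP_dual_A_apply] at h

/-- Flow entering at the owner only moves to later states and never returns, so the pivot element is
1. -/
theorem valueLP_tableauColumn_owner (hP : ∀ a t, P a t ≠ 0 → owner a < t)
    (hβ : ∀ s, owner (β s) = s) (a : Fin m) :
    (valueLP owner P c).dual.tableauColumn β a (owner a) = 1 := by
  have hself : P a (owner a) = 0 := by
    by_contra h
    exact lt_irrefl _ (hP _ _ h)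
  have hlt : ∀ i, i < owner a → (valueLP owner P c).dual.tableauColumn β a i = 0 := by
    intro i
    induction i using WellFoundedLT.induction with
    | ind i ih =>
      intro hi
      have hz : P a i = 0 := by
        by_contra h
        exact lt_asymm hi (hP _ _ h)
      rw [valueLP_tableauColumn_apply hP hβ, if_neg hi.ne', hz, sub_zero, zero_add]
      refine Finset.sum_eq_zero fun j _ => ?_
      by_cases hj : P (β j) i = 0
      · simp [hj]
      · have hji := hP _ _ hj
        rw [hβ] at hji
        rw [ih j hji (hji.trans hi), mul_zero]
  rw [valueLP_tableauColumn_apply hP hβ, if_pos rfl, hself, sub_zero, add_eq_left]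
  refine Finset.sum_eq_zero fun j _ => ?_
  by_cases hj : P (β j) (owner a) = 0
  · simp [hj]
  · have hji := hP _ _ hj
    rw [hβ] at hji
    rw [hlt j hji, mul_zero]

/-- With x the basic solution, o the owner of `a` and u the tableau column, d = x - x_o u vanishes
at o and elsewhere satisfies a flow recursion with inflow at least 1. The resulting slack 1 makes
the owner's row the strict winner of the ratio test, so ties never arise. -/
theorem valueLP_tableauColumn_mul_le (hP : ∀ a t, P a t ≠ 0 → owner a < t)
    (hP0 : ∀ a t, 0 ≤ P a t) (hβ : ∀ s, owner (β s) = s) (a : Fin m) (i : Fin N) :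
    (valueLP owner P c).dual.tableauColumn β a i *
        (valueLP owner P c).dual.basicSolution β (owner a) ≤
      (valueLP owner P c).dual.basicSolution β i - if owner a = i then 0 else 1 := by
  induction i using WellFoundedLT.induction with
  | ind i ih =>
    split_ifs with hi
    · subst hi
      rw [valueLP_tableauColumn_owner hP hβ, one_mul, sub_zero]
    · have h := valueLP_inv_mulVec_apply (c := c) hP hβ (valueLP owner P c).dual.b i
      change (valueLP owner P c).dual.basicSolution β i =
        1 + ∑ j, P (β j) i * (valueLP owner P c).dual.basicSolution β j at h
      rw [h, valueLP_tableauColumn_apply hP hβ, if_neg hi, add_sub_cancel_left, add_mul,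
        Finset.sum_mul]
      have hx := zero_le_one.trans
        (valueLP_one_le_basicSolution (c := c) hP hP0 hβ (owner a))
      have h1 : (0 - P a i) * (valueLP owner P c).dual.basicSolution β (owner a) ≤ 0 :=
        mul_nonpos_of_nonpos_of_nonneg (by linarith [hP0 a i]) hx
      refine (add_le_of_nonpos_left h1).trans (Finset.sum_le_sum fun j _ => ?_)
      rw [mul_assoc]
      by_cases hz : P (β j) i = 0
      · simp [hz]
      · have hj := hP _ _ hz
        rw [hβ] at hj
        refine mul_le_mul_of_nonneg_left ((ih j hj).trans ?_) (hP0 _ _)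
        split_ifs <;> linarith

/-- If all transitions lead to states of larger index, then a pivot at a policy replaces the action
at one state by the improving action of least index. -/
theorem valueLP_blandPivot (hP : ∀ a t, P a t ≠ 0 → owner a < t)
    (hP0 : ∀ a t, 0 ≤ P a t) (hβ : ∀ s, owner (β s) = s) (a : Fin m)
    (ha : 0 < (valueLP owner P c).dual.reducedCost β a)
    (hmin : ∀ k < a, (valueLP owner P c).dual.reducedCost β k ≤ 0) :
    (valueLP owner P c).dual.BlandPivot β (Function.update β (owner a) a) := by
  refine ⟨⟨valueLP_isUnit_det hP hβ, fun i =>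
    zero_le_one.trans (valueLP_one_le_basicSolution hP hP0 hβ i)⟩, a, owner a,
    ⟨ha, fun k hk => ?_⟩, ⟨?_, fun k hk => ?_⟩, rfl⟩
  · by_contra h
    exact absurd hk (not_lt.2 (hmin k (not_le.1 h)))
  · rw [valueLP_tableauColumn_owner hP hβ]
    exact one_pos
  · rw [valueLP_tableauColumn_owner hP hβ, div_one]
    have h := valueLP_tableauColumn_mul_le (c := c) hP hP0 hβ a k
    split_ifs at h with hka
    · subst hka
      rw [valueLP_tableauColumn_owner hP hβ, div_one]
      exact ⟨le_rfl, fun _ => le_rfl⟩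
    · have hlt : (valueLP owner P c).dual.basicSolution β (owner a) <
          (valueLP owner P c).dual.basicSolution β k /
            (valueLP owner P c).dual.tableauColumn β a k := by
        rw [lt_div_iff₀ hk]
        linarith
      exact ⟨hlt.le, fun he => absurd he hlt.ne⟩

end Triangular

/-! ### Counting steps of a relation. -/

/-- `StepsTo R k a b` says that `k` consecutive `R`-steps lead from `a` to `b`. -/
def StepsTo {α : Type*} (R : α → α → Prop) : ℕ → α → α → Prop
  | 0, a, b => a = b
  | k + 1, a, b => ∃ d, R a d ∧ StepsTo R k d b

namespace StepsTo

variable {α : Type*} {R : α → α → Prop}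

theorem single {a b : α} (h : R a b) : StepsTo R 1 a b := ⟨b, h, rfl⟩

theorem trans {k l : ℕ} {a b d : α} (h : StepsTo R k a b) (h' : StepsTo R l b d) :
    StepsTo R (k + l) a d := by
  induction k generalizing a with
  | zero => cases h; rwa [Nat.zero_add]
  | succ k ih =>
    obtain ⟨e, he, h⟩ := h
    rw [Nat.add_right_comm]
    exact ⟨e, he, ih h⟩

theorem exists_seq {k : ℕ} {a b : α} (h : StepsTo R k a b) :
    ∃ f : ℕ → α, f 0 = a ∧ ∀ t < k, R (f t) (f (t + 1)) := by
  induction k generalizing a with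
  | zero => exact ⟨fun _ => a, rfl, fun t ht => absurd ht (Nat.not_lt_zero t)⟩
  | succ k ih =>
    obtain ⟨e, he, h⟩ := h
    obtain ⟨f, h0, hf⟩ := ih h
    refine ⟨fun t => Nat.casesOn t a f, rfl, fun t ht => ?_⟩
    cases t with
    | zero => simpa [h0] using he
    | succ t => exact hf t (by omega)

end StepsTo

/-! ## The ladder

Level `k < n` of the ladder has the two states `2 k` and `2 k + 1`. A bit at each of them chooses
which of the two states of level `k + 1` is the next one: `true` stands for `2 k + 2` and `false`
for `2 k + 3`. The reward of the choice `b` at state `s` is `r s b`. The states of level `n` are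
sinks whose rewards differ by `W`. -/

namespace Ladder

/-- The value of the choice `b` at state `s` relative to the value of the second state of the next
level, if the values of the two states of the next level differ by `g`. -/
def choiceValue (r : ℕ → Bool → ℝ) (s : ℕ) (b : Bool) (g : ℝ) : ℝ :=
  r s b + if b then g else 0

/-- The difference of the values of the two states of level `k`. -/
noncomputable def gap (n : ℕ) (r : ℕ → Bool → ℝ) (W : ℝ) (π : ℕ → Bool) (k : ℕ) : ℝ :=
  if k < n then
    choiceValue r (2 * k) (π (2 * k)) (gap n r W π (k + 1)) -
      choiceValue r (2 * k + 1) (π (2 * k + 1)) (gap n r W π (k + 1))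
  else W
termination_by n - k

/-- Changing the bit at state `s` increases the value of `s`. -/
def Improving (n : ℕ) (r : ℕ → Bool → ℝ) (W : ℝ) (π : ℕ → Bool) (s : ℕ) : Prop :=
  choiceValue r s (π s) (gap n r W π (s / 2 + 1)) <
    choiceValue r s (!π s) (gap n r W π (s / 2 + 1))

/-- The bit at the first state where this is an improvement is changed. -/
def Step (n : ℕ) (r : ℕ → Bool → ℝ) (W : ℝ) (π π' : ℕ → Bool) : Prop :=
  ∃ s < 2 * n, Improving n r W π s ∧ (∀ s' < s, ¬ Improving n r W π s') ∧
    π' = Function.update π s (!π s)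

/-- Rewards that differ by at most `1 / 2` from `0` at the first states (where they are exact) and
from `4 ^ (k + 1)` at the second states. -/
structure Rewards (n : ℕ) (r : ℕ → Bool → ℝ) : Prop where
  first : ∀ k < n, ∀ b, r (2 * k) b = 0
  second : ∀ k < n, ∀ b, |r (2 * k + 1) b - 4 ^ (k + 1)| ≤ 1 / 2

/-- `g` has the sign `σ` and is large at the scale of level `k`. -/
def HasSign (k : ℕ) (σ : Bool) (g : ℝ) : Prop :=
  4 ^ (k + 1) - 1 / 2 ≤ if σ then g else -g

/-- The bits below level `k` that are optimal if the gap of level `k` has the sign `σ`. -/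
def AtRest (k : ℕ) (σ : Bool) (π : ℕ → Bool) : Prop :=
  ∀ s < 2 * k, π s = (σ && decide (2 * k ≤ s + 2))

variable {n : ℕ} {r : ℕ → Bool → ℝ} {W : ℝ} {π : ℕ → Bool}

theorem gap_of_lt {k : ℕ} (h : k < n) : gap n r W π k =
    choiceValue r (2 * k) (π (2 * k)) (gap n r W π (k + 1)) -
      choiceValue r (2 * k + 1) (π (2 * k + 1)) (gap n r W π (k + 1)) := by
  rw [gap, if_pos h]

theorem gap_of_le {k : ℕ} (h : n ≤ k) : gap n r W π k = W := by
  rw [gap, if_neg (not_lt.2 h)]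

/-- Values depend only on later states, so a run below level `k` cannot disturb the sign that
triggered it. -/
theorem gap_congr {π' : ℕ → Bool} {k : ℕ} (h : ∀ s, 2 * k ≤ s → π s = π' s) :
    gap n r W π k = gap n r W π' k := by
  induction hd : n - k generalizing k with
  | zero => rw [gap_of_le (by omega), gap_of_le (by omega)]
  | succ d ih =>
    have hk : k < n := by omega
    rw [gap_of_lt hk, gap_of_lt hk, ih (fun s hs => h s (by omega)) (by omega), h _ le_rfl,
      h _ (Nat.le_succ _)]

theorem four_le_pow (k : ℕ) : (4 : ℝ) ≤ 4 ^ (k + 1) := by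
  have : (1 : ℝ) ≤ 4 ^ k := one_le_pow₀ (by norm_num)
  rw [pow_succ]
  linarith

/-- The gap of a level is negative if its two bits agree. -/
theorem hasSign_gap_of_eq (hr : Rewards n r) {k : ℕ} (hk : k < n)
    (h : π (2 * k) = π (2 * k + 1)) : HasSign k false (gap n r W π k) := by
  have h1 := abs_le.1 (hr.second k hk (π (2 * k + 1)))
  rw [gap_of_lt hk, HasSign, choiceValue, choiceValue, hr.first k hk, h]
  simp only [Bool.false_eq_true, if_false]
  linarith [h1.1]

/-- The gap of a level is positive if only its first bit is up to date. -/
theorem hasSign_gap_of_ne (hr : Rewards n r) {k : ℕ} (hk : k < n) {σ : Bool}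
    (hg : HasSign (k + 1) σ (gap n r W π (k + 1))) (h : π (2 * k) = σ)
    (h' : π (2 * k + 1) = !σ) : HasSign k true (gap n r W π k) := by
  have h1 := abs_le.1 (hr.second k hk (!σ))
  have h4 := four_le_pow k
  -- The ratio 4 between levels pays for all errors: 4 · 4^(k+1) - 1/2 - (4^(k+1) + 1/2) = 3 ·
  -- 4^(k+1) - 1, which exceeds 4^(k+1) - 1/2.
  rw [HasSign, pow_succ _ (k + 1)] at hg
  rw [gap_of_lt hk, HasSign, choiceValue, choiceValue, hr.first k hk, h, h']
  cases σ <;> simp at hg h1 ⊢ <;> linarith [h1.1, h1.2]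

/-- A bit is improving exactly if it differs from the sign of the gap of the next level. -/
theorem improving_iff (hr : Rewards n r) {s : ℕ} (hs : s < 2 * n) {σ : Bool}
    (hg : HasSign (s / 2 + 1) σ (gap n r W π (s / 2 + 1))) :
    Improving n r W π s ↔ π s = !σ := by
  have h4 := four_le_pow (s / 2 + 1)
  -- Perturbation separates the two rewards of a state by at most 1, whereas the next gap is at
  -- least 4 - 1/2 in absolute value.
  have hd : |r s (π s) - r s (!π s)| ≤ 1 := by
    obtain ⟨k, rfl | rfl⟩ : ∃ k, s = 2 * k ∨ s = 2 * k + 1 := ⟨s / 2, by omega⟩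
    · rw [hr.first k (by omega), hr.first k (by omega)]
      norm_num
    · have h1 := abs_le.1 (hr.second k (by omega) (π (2 * k + 1)))
      have h2 := abs_le.1 (hr.second k (by omega) (!π (2 * k + 1)))
      rw [abs_le]
      constructor <;> linarith [h1.1, h1.2, h2.1, h2.2]
  obtain ⟨hd1, hd2⟩ := abs_le.1 hd
  rw [HasSign] at hg
  rw [Improving, choiceValue, choiceValue]
  cases σ <;> cases hb : π s <;> simp [hb] at hg hd1 hd2 ⊢ <;> linarith

/-- The bits of level `k - 1` match the sign of the gap above them. On every level below `k` the two
bits agree, so all these gaps are negative, and the bits further down are rightly `false`. -/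
theorem AtRest.not_improving (hr : Rewards n r) {k : ℕ} (hk : k ≤ n) {σ : Bool}
    (h : AtRest k σ π) (hg : HasSign k σ (gap n r W π k)) {s : ℕ} (hs : s < 2 * k) :
    ¬ Improving n r W π s := by
  by_cases hsk : s / 2 + 1 = k
  · rw [← hsk] at hg
    rw [improving_iff hr (by omega) hg, h s hs, decide_eq_true (by omega)]
    simp
  · have hf : ∀ t, t + 2 < 2 * k → π t = false := fun t ht => by
      rw [h t (by omega), decide_eq_false (by omega), Bool.and_false]
    have hg' : HasSign (s / 2 + 1) false (gap n r W π (s / 2 + 1)) := by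
      by_cases htop : s / 2 + 2 = k
      · refine hasSign_gap_of_eq hr (by omega) ?_
        rw [h _ (by omega), h _ (by omega), decide_eq_true (by omega), decide_eq_true (by omega)]
      · refine hasSign_gap_of_eq hr (by omega) ?_
        rw [hf _ (by omega), hf _ (by omega)]
    rw [improving_iff hr (by omega) hg', hf s (by omega)]
    simp

/-- A change of the sign of the gap of level `k` is followed by `2 ^ (k + 1) - 2` steps below
level `k`. -/
theorem exists_stepsTo (hr : Rewards n r) (k : ℕ) (hk : k ≤ n) (π : ℕ → Bool) (σ : Bool)
    (h : AtRest k (!σ) π) (hg : HasSign k σ (gap n r W π k)) :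
    ∃ π', StepsTo (Step n r W) (2 ^ (k + 1) - 2) π π' ∧ AtRest k σ π' ∧
      ∀ s, 2 * k ≤ s → π' s = π s := by
  induction k generalizing π σ with
  | zero => exact ⟨π, rfl, fun s hs => absurd hs (Nat.not_lt_zero s), fun _ _ => rfl⟩
  | succ k ih =>
    have hkn : k < n := hk
    have hx : π (2 * k) = !σ := by
      rw [h _ (by omega), decide_eq_true (by omega), Bool.and_true]
    have hy : π (2 * k + 1) = !σ := by
      rw [h _ (by omega), decide_eq_true (by omega), Bool.and_true]
    -- Below its top level a rest configuration is all `false`, whatever its sign.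
    have hrest : AtRest k false π := fun s hs => by
      rw [h _ (by omega), decide_eq_false (by omega), Bool.and_false, Bool.false_and]
    -- the first state of level `k` changes its choice
    set π₁ := Function.update π (2 * k) σ with hπ₁
    have hπ₁_ne : ∀ s, s ≠ 2 * k → π₁ s = π s := fun s hs => Function.update_of_ne hs _ _
    have hπ₁x : π₁ (2 * k) = σ := Function.update_self _ _ _
    have hg0 := hasSign_gap_of_eq (W := W) hr hkn (hx.trans hy.symm)
    have hstep₁ : Step n r W π π₁ := by
      refine ⟨2 * k, by omega, ?_, fun s hs => hrest.not_improving hr hkn.le hg0 hs, ?_⟩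
      · rw [improving_iff (σ := σ) hr (by omega) (by
          rwa [Nat.mul_div_cancel_left k (by norm_num : 0 < 2)])]
        exact hx
      · rw [hx, Bool.not_not]
    have hg₁' : HasSign (k + 1) σ (gap n r W π₁ (k + 1)) := by
      rwa [gap_congr fun s hs => hπ₁_ne s (by omega)]
    have hg₁ : HasSign k true (gap n r W π₁ k) :=
      hasSign_gap_of_ne hr hkn hg₁' hπ₁x ((hπ₁_ne _ (by omega)).trans hy)
    have hrest₁ : AtRest k (!true) π₁ := fun s hs => by
      rw [hπ₁_ne s (by omega)]
      exact hrest s hs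
    obtain ⟨π₂, hrun₁, hrest₂, heq₂⟩ := ih hkn.le π₁ true hrest₁ hg₁
    -- the second state of level `k` changes its choice
    have hg₂ : HasSign k true (gap n r W π₂ k) := by rwa [gap_congr heq₂]
    have hg₂' : HasSign (k + 1) σ (gap n r W π₂ (k + 1)) := by
      rwa [gap_congr fun s hs => heq₂ s (by omega)]
    have hx₂ : π₂ (2 * k) = σ := (heq₂ _ le_rfl).trans hπ₁x
    have hy₂ : π₂ (2 * k + 1) = !σ :=
      (heq₂ _ (by omega)).trans ((hπ₁_ne _ (by omega)).trans hy)
    set π₃ := Function.update π₂ (2 * k + 1) σ with hπ₃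
    have hπ₃_ne : ∀ s, s ≠ 2 * k + 1 → π₃ s = π₂ s := fun s hs => Function.update_of_ne hs _ _
    have hπ₃y : π₃ (2 * k + 1) = σ := Function.update_self _ _ _
    have hπ₃x : π₃ (2 * k) = σ := (hπ₃_ne _ (by omega)).trans hx₂
    have hstep₂ : Step n r W π₂ π₃ := by
      refine ⟨2 * k + 1, by omega, ?_, fun s hs => ?_, ?_⟩
      · rw [improving_iff (σ := σ) hr (by omega) (by
          rwa [show (2 * k + 1) / 2 = k by omega])]
        exact hy₂
      · rcases Nat.lt_succ_iff_lt_or_eq.1 hs with hs | rfl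
        · exact hrest₂.not_improving hr hkn.le hg₂ hs
        · rw [improving_iff (σ := σ) hr (by omega) (by
            rwa [Nat.mul_div_cancel_left k (by norm_num : 0 < 2)]), hx₂]
          simp
      · rw [hy₂, Bool.not_not]
    have hg₃ : HasSign k false (gap n r W π₃ k) :=
      hasSign_gap_of_eq hr hkn (hπ₃x.trans hπ₃y.symm)
    have hrest₃ : AtRest k (!false) π₃ := fun s hs => by
      rw [hπ₃_ne s (by omega)]
      exact hrest₂ s hs
    obtain ⟨π₄, hrun₂, hrest₄, heq₄⟩ := ih hkn.le π₃ false hrest₃ hg₃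
    refine ⟨π₄, ?_, fun s hs => ?_, fun s hs => ?_⟩
    · have hlen : 2 ^ (k + 1 + 1) - 2 =
          1 + (2 ^ (k + 1) - 2) + (1 + (2 ^ (k + 1) - 2)) := by
        have : 1 ≤ 2 ^ k := Nat.one_le_two_pow
        rw [pow_succ, pow_succ]
        omega
      rw [hlen]
      exact ((StepsTo.single hstep₁).trans hrun₁).trans ((StepsTo.single hstep₂).trans hrun₂)
    · by_cases hsk : s < 2 * k
      · rw [hrest₄ s hsk, decide_eq_false (p := 2 * (k + 1) ≤ s + 2) (by omega), Bool.and_false,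
          Bool.false_and]
      · rw [decide_eq_true (by omega), Bool.and_true, heq₄ s (by omega)]
        obtain rfl | rfl : s = 2 * k ∨ s = 2 * k + 1 := by omega
        · exact hπ₃x
        · exact hπ₃y
    · rw [heq₄ s (by omega), hπ₃_ne s (by omega), heq₂ s (by omega), hπ₁_ne s (by omega)]

end Ladder

/-! ### The ladder as an MDP, and its robustness under perturbation. -/

namespace Ladder

/-- The state to which the choice `a % 2` at state `a / 2` of the ladder leads. -/
def target (a : ℕ) : ℕ := 2 * (a / 4) + 3 - a % 2

/-- The ladder with `n` levels as a Markov decision process on `N ≥ 2 n + 2` states. Actions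
`2 s` and `2 s + 1` are available at a state `s < 2 n`, and action `s + 2 n` is available at a sink
`s ≥ 2 n`. -/
noncomputable def mdp (n N : ℕ) (hN : 2 * n + 2 ≤ N) : MDP N (N + 2 * n) where
  owner a := ⟨if (a : ℕ) < 4 * n then a / 2 else a - 2 * n, by split_ifs <;> omega⟩
  P a s := if (a : ℕ) < 4 * n ∧ (s : ℕ) = target a then 1 else 0
  c a := if (a : ℕ) < 4 * n then if (a : ℕ) % 4 < 2 then 0 else 4 ^ ((a : ℕ) / 4 + 1)
    else if (a : ℕ) = 4 * n then 4 ^ (n + 1) else 0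
  owner_surjective s := by
    by_cases hs : (s : ℕ) < 2 * n
    · exact ⟨⟨2 * s, by omega⟩, Fin.ext (by simp only; split_ifs <;> omega)⟩
    · exact ⟨⟨s + 2 * n, by omega⟩, Fin.ext (by simp only; split_ifs <;> omega)⟩
  P_nonneg a s := by split_ifs <;> norm_num
  P_sum a := by
    by_cases ha : (a : ℕ) < 4 * n
    · left
      -- The target stays below `N` because level `n` ends at state 2n + 1.
      rw [Finset.sum_eq_single ⟨target a, by unfold target; omega⟩ (fun s _ hs => ?_) (by simp)]
      · simp [ha]
      · exact if_neg fun h => hs (Fin.ext h.2)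
    · exact Or.inr fun s => if_neg fun h => ha h.1
  terminates π hπ s := by
    induction hd : N - s using Nat.strong_induction_on generalizing s with
    | h d ih =>
      have ho := congrArg Fin.val (hπ s)
      simp only at ho
      by_cases ha : (π s : ℕ) < 4 * n
      · rw [if_pos ha] at ho
        obtain ⟨t, hst, ht⟩ := ih (N - target (π s)) (by unfold target; omega)
          ⟨target (π s), by unfold target; omega⟩ rfl
        exact ⟨t, Relation.ReflTransGen.head (by simp [ha]) hst, ht⟩
      · exact ⟨s, .refl, fun v => if_neg fun h => ha h.1⟩

/-- The action at state `s` that is chosen by the bit `b`; a sink has only one action. -/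
def action (n N : ℕ) (s : Fin N) (b : Bool) : Fin (N + 2 * n) :=
  ⟨if (s : ℕ) < 2 * n then 2 * s + b.toNat else s + 2 * n, by
    have := Bool.toNat_le b
    split_ifs <;> omega⟩

/-- The policy that is given by the bits `π`. -/
def policy (n N : ℕ) (π : ℕ → Bool) (s : Fin N) : Fin (N + 2 * n) :=
  action n N s (π s)

/-- The rewards of the choices under rewards `c` of the actions. -/
def choiceReward {m : ℕ} (c : Fin m → ℝ) (s : ℕ) (b : Bool) : ℝ :=
  if h : 2 * s + b.toNat < m then c ⟨2 * s + b.toNat, h⟩ else 0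

variable {n N : ℕ} {hN : 2 * n + 2 ≤ N}

theorem owner_action (s : Fin N) (b : Bool) : (mdp n N hN).owner (action n N s b) = s := by
  have := Bool.toNat_lt b
  refine Fin.ext ?_
  simp only [mdp, action]
  split_ifs <;> omega

theorem owner_policy (π : ℕ → Bool) (s : Fin N) :
    (mdp n N hN).owner (policy n N π s) = s := owner_action s _

theorem owner_lt_of_P_ne_zero (a : Fin (N + 2 * n)) (t : Fin N) (h : (mdp n N hN).P a t ≠ 0) :
    (mdp n N hN).owner a < t := by
  obtain ⟨ha, ht⟩ := (ite_ne_right_iff.1 h).1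
  rw [Fin.lt_def, ht]
  simp only [mdp, target, if_pos ha]
  omega

/-- The probabilities of the ladder are `0` and `1`, so that they are not perturbed. -/
theorem eq_P_of_isSmoothed {P' : Fin (N + 2 * n) → Fin N → ℝ} {c' : Fin (N + 2 * n) → ℝ} {σ : ℝ}
    (h : (mdp n N hN).IsSmoothed σ P' c') : P' = (mdp n N hN).P := by
  funext a s
  by_cases hs : (mdp n N hN).P a s = 0
  · rw [hs, (h.P_support a s).2 hs]
  · obtain ⟨-, hs'⟩ := (ite_ne_right_iff.1 hs).1
    -- A row with a single nonzero entry is determined by its sum.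
    have hsum := h.P_sum a
    have hz : ∀ t, t ≠ s → (mdp n N hN).P a t = 0 := fun t ht =>
      if_neg fun hta => ht (Fin.ext (hta.2.trans hs'.symm))
    rwa [Finset.sum_eq_single s (fun t _ ht => (h.P_support a t).2 (hz t ht)) (by simp),
      Finset.sum_eq_single s (fun t _ ht => hz t ht) (by simp)] at hsum

theorem rewards_of_isSmoothed {P' : Fin (N + 2 * n) → Fin N → ℝ} {c' : Fin (N + 2 * n) → ℝ}
    (h : (mdp n N hN).IsSmoothed (1 / 2) P' c') : Rewards n (choiceReward c') where
  first k hk b := by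
    have hb := Bool.toNat_lt b
    rw [choiceReward, dif_pos (by omega)]
    refine h.c_zero _ ?_
    simp only [mdp]
    rw [if_pos (by omega), if_pos (by omega)]
  second k hk b := by
    have hb := Bool.toNat_lt b
    rw [choiceReward, dif_pos (by omega)]
    have hc := h.c_close ⟨2 * (2 * k + 1) + b.toNat, by omega⟩
    simp only [mdp] at hc
    rwa [if_pos (by omega), if_neg (by omega),
      show (2 * (2 * k + 1) + b.toNat) / 4 = k by omega] at hc

/-! ### Values, reduced costs and pivots of the ladder. -/

section Values

variable {c : Fin (N + 2 * n) → ℝ} {π : ℕ → Bool}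

/-- The values of the states of the ladder under the policy that is given by the bits `π`. -/
noncomputable def value (n N : ℕ) (hN : 2 * n + 2 ≤ N) (c : Fin (N + 2 * n) → ℝ) (π : ℕ → Bool)
    (s : ℕ) : ℝ :=
  if h : s < N then
    (valueLP (mdp n N hN).owner (mdp n N hN).P c).dual.multipliers (policy n N π) ⟨s, h⟩ else 0

theorem action_value (s : ℕ) (hs : s < 2 * n) (b : Bool) :
    c (action n N ⟨s, by omega⟩ b) + ∑ t, (mdp n N hN).P (action n N ⟨s, by omega⟩ b) t *
        (valueLP (mdp n N hN).owner (mdp n N hN).P c).dual.multipliers (policy n N π) t =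
      choiceValue (choiceReward c) s b
        (value n N hN c π (2 * (s / 2 + 1)) - value n N hN c π (2 * (s / 2 + 1) + 1)) +
      value n N hN c π (2 * (s / 2 + 1) + 1) := by
  have hb := Bool.toNat_lt b
  have ha : ((action n N ⟨s, by omega⟩ b : Fin (N + 2 * n)) : ℕ) = 2 * s + b.toNat := if_pos hs
  -- Each level owns four consecutive actions, and the odd action of a state leads to the first
  -- state of the next level.
  have ht : target (2 * s + b.toNat) = 2 * (s / 2 + 1) + 1 - b.toNat := by
    unfold target
    omega
  rw [Finset.sum_eq_single ⟨2 * (s / 2 + 1) + 1 - b.toNat, by omega⟩ (fun t _ hne => ?_) (by simp)]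
  · have hP : (mdp n N hN).P (action n N ⟨s, by omega⟩ b)
        ⟨2 * (s / 2 + 1) + 1 - b.toNat, by omega⟩ = 1 :=
      if_pos ⟨by omega, by rw [ha, ht]⟩
    have hc : c (action n N ⟨s, by omega⟩ b) = choiceReward c s b := by
      rw [choiceReward, dif_pos (by omega)]
      exact congrArg c (Fin.ext ha)
    rw [hP, one_mul, hc, choiceValue, value, value, dif_pos (by omega), dif_pos (by omega)]
    cases b <;> simp [add_assoc]
  · have hP : (mdp n N hN).P (action n N ⟨s, by omega⟩ b) t = 0 :=
      if_neg fun h => hne (Fin.ext (by rw [h.2, ha, ht]))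
    rw [hP, zero_mul]

theorem value_of_lt (s : ℕ) (hs : s < 2 * n) : value n N hN c π s =
    choiceValue (choiceReward c) s (π s)
        (value n N hN c π (2 * (s / 2 + 1)) - value n N hN c π (2 * (s / 2 + 1) + 1)) +
      value n N hN c π (2 * (s / 2 + 1) + 1) := by
  rw [← action_value s hs (π s), value, dif_pos (by omega),
    valueLP_multipliers_apply owner_lt_of_P_ne_zero (owner_policy π)]
  rfl

theorem value_of_le (s : ℕ) (hs : 2 * n ≤ s) (hsN : s < N) :
    value n N hN c π s = c ⟨s + 2 * n, by omega⟩ := by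
  have ha : policy n N π ⟨s, hsN⟩ = ⟨s + 2 * n, by omega⟩ := Fin.ext (if_neg (by simpa using hs))
  rw [value, dif_pos hsN, valueLP_multipliers_apply owner_lt_of_P_ne_zero (owner_policy π), ha,
    add_eq_left]
  refine Finset.sum_eq_zero fun t _ => ?_
  have hP : (mdp n N hN).P ⟨s + 2 * n, by omega⟩ t = 0 :=
    if_neg fun h => absurd h.1 (by simp only; omega)
  rw [hP, zero_mul]

/-- Only differences within a level matter: the value of the second state of level `k + 1` is common
to both states of level `k` and cancels. -/
theorem value_sub_value (k : ℕ) (hk : k ≤ n) :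
    value n N hN c π (2 * k) - value n N hN c π (2 * k + 1) =
      gap n (choiceReward c) (c ⟨4 * n, by omega⟩ - c ⟨4 * n + 1, by omega⟩) π k := by
  induction hd : n - k generalizing k with
  | zero =>
    obtain rfl : k = n := by omega
    rw [gap_of_le le_rfl, value_of_le _ le_rfl (by omega), value_of_le _ (by omega) (by omega)]
    congr 3 <;> omega
  | succ d ih =>
    rw [gap_of_lt (show k < n by omega), ← ih (k + 1) (by omega) (by omega),
      value_of_lt (2 * k) (by omega), value_of_lt (2 * k + 1) (by omega), Nat.mul_div_cancel_left k (by norm_num : 0 < 2),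
      show (2 * k + 1) / 2 = k by omega, add_sub_add_right_eq_sub]

theorem reducedCost_action (s : ℕ) (hs : s < 2 * n) (b : Bool) :
    (valueLP (mdp n N hN).owner (mdp n N hN).P c).dual.reducedCost (policy n N π)
        (action n N ⟨s, by omega⟩ b) =
      choiceValue (choiceReward c) s b (gap n (choiceReward c)
          (c ⟨4 * n, by omega⟩ - c ⟨4 * n + 1, by omega⟩) π (s / 2 + 1)) -
        choiceValue (choiceReward c) s (π s) (gap n (choiceReward c)
          (c ⟨4 * n, by omega⟩ - c ⟨4 * n + 1, by omega⟩) π (s / 2 + 1)) := by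
  have hv := value_of_lt (hN := hN) (c := c) (π := π) s hs
  rw [valueLP_reducedCost, owner_action, action_value s hs,
    ← value_sub_value (hN := hN) _ (by omega)]
  rw [value, dif_pos (by omega)] at hv
  rw [hv, add_sub_add_right_eq_sub]

/-- A step of the ladder is a pivot of the simplex method. -/
theorem Step.blandPivot {π' : ℕ → Bool}
    (h : Step n (choiceReward c) (c ⟨4 * n, by omega⟩ - c ⟨4 * n + 1, by omega⟩) π π') :
    (valueLP (mdp n N hN).owner (mdp n N hN).P c).dual.BlandPivot (policy n N π)
      (policy n N π') := by
  obtain ⟨s, hs, himp, hmin, rfl⟩ := h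
  have hpol : policy n N (Function.update π s (!π s)) =
      Function.update (policy n N π) ((mdp n N hN).owner (action n N ⟨s, by omega⟩ (!π s)))
        (action n N ⟨s, by omega⟩ (!π s)) := by
    rw [owner_action]
    funext t
    by_cases hts : t = ⟨s, by omega⟩
    · subst hts
      simp [policy]
    · have hts' : (t : ℕ) ≠ s := fun h => hts (Fin.ext h)
      simp [policy, hts, hts']
  rw [hpol]
  refine valueLP_blandPivot owner_lt_of_P_ne_zero (mdp n N hN).P_nonneg (owner_policy π) _ ?_
    fun a ha => ?_
  · rw [reducedCost_action s hs]
    exact sub_pos.2 himp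
  · have hb := Bool.toNat_lt (!π s)
    have ha' : (a : ℕ) < 2 * s + (!π s).toNat := by
      have h := Fin.lt_def.1 ha
      simp only [action, if_pos hs] at h
      exact h
    have hodd : (decide ((a : ℕ) % 2 = 1)).toNat = (a : ℕ) % 2 := by
      rcases Nat.mod_two_eq_zero_or_one (a : ℕ) with h | h <;> simp [h]
    have hau : a = action n N ⟨(a : ℕ) / 2, by omega⟩ (decide ((a : ℕ) % 2 = 1)) := by
      refine Fin.ext ?_
      simp only [action]
      rw [if_pos (by omega), hodd]
      omega
    rw [hau, reducedCost_action _ (by omega), sub_nonpos]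
    -- Either `a` is already in the policy and has reduced cost 0, or it flips a bit; at `s` itself
    -- the flipping action is the entering one, so the state must be earlier.
    by_cases hbit : decide ((a : ℕ) % 2 = 1) = π ((a : ℕ) / 2)
    · rw [hbit]
    · rw [Bool.eq_not_of_ne hbit]
      refine not_lt.1 (hmin _ ?_)
      by_contra hlt
      have has : (a : ℕ) / 2 = s := by omega
      rw [has] at hbit
      rw [← Bool.eq_not_of_ne hbit, hodd] at ha'
      omega

end Values

theorem le_mdpBlandPivots {P' : Fin (N + 2 * n) → Fin N → ℝ} {c' : Fin (N + 2 * n) → ℝ}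
    (h : (mdp n N hN).IsSmoothed (1 / 2) P' c') :
    ((2 ^ (n + 1) - 2 : ℕ) : ℕ∞) ≤
      mdpBlandPivots (mdp n N hN).owner P' c' (policy n N fun _ => false) := by
  rw [eq_P_of_isSmoothed h]
  -- The second sink has reward exactly 0, so only one error of 1/2 enters and the top gap has sign
  -- `true` at scale `n`.
  have hW : 4 ^ (n + 1) - 1 / 2 ≤ c' ⟨4 * n, by omega⟩ - c' ⟨4 * n + 1, by omega⟩ := by
    have h0 := h.c_close ⟨4 * n, by omega⟩
    have h1 := h.c_zero ⟨4 * n + 1, by omega⟩ (by simp [mdp])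
    simp only [mdp, lt_irrefl, if_false, if_true] at h0
    rw [h1, sub_zero]
    linarith [(abs_le.1 h0).1]
  obtain ⟨π', hrun, -⟩ := exists_stepsTo (rewards_of_isSmoothed h) n le_rfl (fun _ => false) true
    (fun s _ => by simp) (W := c' ⟨4 * n, by omega⟩ - c' ⟨4 * n + 1, by omega⟩)
    (by rwa [gap_of_le le_rfl])
  obtain ⟨f, hf0, hf⟩ := hrun.exists_seq
  exact le_iSup₂_of_le (2 ^ (n + 1) - 2)
    ⟨fun t => policy n N (f t), by simp only [hf0], fun t ht => (hf t ht).blandPivot⟩ le_rfl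

end Ladder

/-! ### Choice of constants and passage to expectations. -/

theorem mainTheorem8 :
    ∃ κ : ℝ, 0 < κ ∧ ∃ C N₀ : ℕ, ∀ N : ℕ, N₀ ≤ N →
      ∃ m : ℕ, m ≤ C * N ∧ ∃ (M : MDP N m) (β₀ : Fin N → Fin m),
        -- every structure-preserving perturbation of up to 1/2
        (∀ (P' : Fin m → Fin N → ℝ) (c' : Fin m → ℝ), M.IsSmoothed (1 / 2) P' c' →
          ENNReal.ofReal ((2 : ℝ) ^ (κ * (N : ℝ))) ≤
            ((mdpBlandPivots M.owner P' c' β₀ : ℕ∞) : ℝ≥0∞)) ∧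
        -- hence the expected number of pivots, for every law of the perturbation
        (∀ μ : Measure ((Fin m → Fin N → ℝ) × (Fin m → ℝ)), IsProbabilityMeasure μ →
          (∀ᵐ x ∂μ, M.IsSmoothed (1 / 2) x.1 x.2) →
          ENNReal.ofReal ((2 : ℝ) ^ (κ * (N : ℝ))) ≤
            ∫⁻ x, ((mdpBlandPivots M.owner x.1 x.2 β₀ : ℕ∞) : ℝ≥0∞) ∂μ) := by
  -- N ≥ 4 gives n ≥ 1, whence N/5 ≤ (2n + 3)/5 ≤ n and 2^n ≤ 2^(n+1) - 2. The constant 2 covers N +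
  -- 2n actions; for odd N a spare sink fills the remaining state.
  refine ⟨1 / 5, by norm_num, 2, 4, fun N hN4 => ?_⟩
  obtain ⟨n, hn, hN, hNn⟩ : ∃ n, 1 ≤ n ∧ 2 * n + 2 ≤ N ∧ N ≤ 2 * n + 3 :=
    ⟨N / 2 - 1, by omega, by omega, by omega⟩
  have hmain : ∀ (P' : Fin (N + 2 * n) → Fin N → ℝ) (c' : Fin (N + 2 * n) → ℝ),
      (Ladder.mdp n N hN).IsSmoothed (1 / 2) P' c' →
      ENNReal.ofReal ((2 : ℝ) ^ ((1 / 5 : ℝ) * (N : ℝ))) ≤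
        ((mdpBlandPivots (Ladder.mdp n N hN).owner P' c'
          (Ladder.policy n N fun _ => false) : ℕ∞) : ℝ≥0∞) := by
    intro P' c' h
    have hexp : (2 : ℝ) ^ ((1 / 5 : ℝ) * (N : ℝ)) ≤ ((2 ^ (n + 1) - 2 : ℕ) : ℝ) := by
      have h1 : (1 : ℝ) ≤ n := by exact_mod_cast hn
      have h2 : (N : ℝ) ≤ 2 * n + 3 := by exact_mod_cast hNn
      have hle : (2 : ℝ) ^ ((1 / 5 : ℝ) * (N : ℝ)) ≤ (2 : ℝ) ^ (n : ℝ) :=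
        Real.rpow_le_rpow_of_exponent_le (by norm_num) (by linarith)
      rw [Real.rpow_natCast] at hle
      have hnat : 2 ^ n ≤ 2 ^ (n + 1) - 2 := by
        have : 2 ^ 1 ≤ 2 ^ n := Nat.pow_le_pow_right (by norm_num) hn
        rw [pow_succ]
        omega
      exact hle.trans (by exact_mod_cast hnat)
    refine (ENNReal.ofReal_le_ofReal hexp).trans ?_
    rw [ENNReal.ofReal_natCast]
    exact_mod_cast ENat.toENNReal_le.2 (Ladder.le_mdpBlandPivots h)
  refine ⟨N + 2 * n, by omega, Ladder.mdp n N hN, Ladder.policy n N fun _ => false, hmain,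
    fun μ hμ hsm => ?_⟩
  calc ENNReal.ofReal ((2 : ℝ) ^ ((1 / 5 : ℝ) * (N : ℝ)))
      = ∫⁻ _, ENNReal.ofReal ((2 : ℝ) ^ ((1 / 5 : ℝ) * (N : ℝ))) ∂μ := by
        rw [lintegral_const, measure_univ, mul_one]
    _ ≤ _ := lintegral_mono_ae (hsm.mono fun x hx => hmain x.1 x.2 hx)
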